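/- For positive integers $L$ and $s$, let $C_{L,s}$ be the set of integer partitions whose smallest part is $s$, all of whose parts are $\le L+s$, and in which $L+s-1$ does not appear as a part. Let $D_{L,s}$ be the set of nonempty partitions with all parts in $\{s+1,\ldots,L+s\}$. If moreover $L\ge s+1$, let $C^{*}_{L,s}$ be the set of partitions whose smallest part is $s$, all of whose parts are $\le L+s$, and in which $L$ does not appear as a part. Write $|\pi|$ for the sum of the parts of a partition $\pi$. Put $$P_{L,s}=(s+1)(s+2)\cdots(s+L),$$ $$\gamma(L,s)=\bigl((s+1)+(s+2)+\cdots+(s+L)\bigr)\Bigl(P_{L,s}^{(P_{L,s}^2-1)L+2}+\bigl((P_{L,s}^2-1)L-2\bigr)P_{L,s}\Bigr),$$ $$\Gamma(s)=\gamma(3s+2,s).$$ Let $L\ge 3$ and $s\geq 1$ be integers. Then for every integer $N\ge\Gamma(s)$, $$|\{\pi\in C_{L,s}:|\pi|=N\}|\ \ge\ |\{\pi\in D_{L,s}:|\pi|=N\}|,$$ and, if in addition $L\ge s+1$, then for every integer $N\ge\Gamma(s)$, $$|\{\pi\in C^{*}_{L,s}:|\pi|=N\}|\ \ge\ |\{\pi\in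 D_{L,s}:|\pi|=N\}|.$$ -/

import Mathlib

namespace PartIneq

/-- `P_{L,s} = (s+1)(s+2)⋯(s+L)`. -/
def P (L s : ℕ) : ℕ := ∏ i ∈ Finset.Icc 1 L, (s + i)

/-- `γ(L,s) = ((s+1)+⋯+(s+L)) · (P^((P²-1)L+2) + ((P²-1)L-2)P)` with `P = P_{L,s}`.
For positive `L` and `s` one has `P ≥ 2`, so none of the subtractions truncates. -/
def gammaBound (L s : ℕ) : ℕ :=
  (∑ i ∈ Finset.Icc 1 L, (s + i)) *
    (P L s ^ ((P L s ^ 2 - 1) * L + 2) + ((P L s ^ 2 - 1) * L - 2) * P L s)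

/-- `Γ(s) = γ(3s+2, s)`. -/
def GammaBound (s : ℕ) : ℕ := gammaBound (3 * s + 2) s

/-- The partitions of `N` in `I_{L,s,k}`: the smallest part is `s` (it occurs, and every part is at
least `s`), all parts are at most `L + s`, and `k` is not a part. -/
def partsI (L s k N : ℕ) : Finset (Nat.Partition N) :=
  Finset.univ.filter fun p =>
    s ∈ p.parts ∧ (∀ i ∈ p.parts, s ≤ i) ∧ (∀ i ∈ p.parts, i ≤ L + s) ∧ k ∉ p.parts

/-- The partitions of `N` in `C_{L,s}`, where the part `L + s - 1` is forbidden. -/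
def partsC (L s N : ℕ) : Finset (Nat.Partition N) := partsI L s (L + s - 1) N

/-- The partitions of `N` in `C*_{L,s}` (considered for `L ≥ s + 1`), where the part `L` is
forbidden. -/
def partsCStar (L s N : ℕ) : Finset (Nat.Partition N) := partsI L s L N

/-- The partitions of `N` in `D_{L,s}`: nonempty, with all parts in `{s+1, …, L+s}`. -/
def partsD (L s N : ℕ) : Finset (Nat.Partition N) :=
  Finset.univ.filter fun p => p.parts ≠ 0 ∧ ∀ i ∈ p.parts, s + 1 ≤ i ∧ i ≤ L + s

end PartIneq

/-! Both inequalities are instances of one statement about an arbitrary forbidden part `k` in `{s+1,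
…, L+s}`. Choose distinct `a, b ≠ k` in `{s+1, s+2, s+3}` and split a partition into the multiset
`ρ` of its remaining parts and the multiplicities of three special parts. With `n = N - |ρ|`, a
partition in `D` gives a solution of `k x + a y + b z = n`. Conversely, a solution of `s x + a y + b
z = n` with `x ≥ 1` gives a partition in `I`. These solution counts grow like `n²/(2kab)` and
`n²/(2sab)` with errors linear in `n`; since `s < k`, the second wins by a quadratic margin for
large `n` (`sq_add_card_le`).

Only those `ρ` with `|ρ|` close to `N` can show a deficit, and it is bounded. Such a `ρ` contains
some part with large total contribution; removing enough copies of it yields a multiset `ρ'` with a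
large surplus. The removed part determines `ρ` from `ρ'`, so few `ρ` reach the same `ρ'`, and the
surpluses cover the deficits (`exists_transport`, `sum_le_sum_of_transport`). The argument works for
all `N ≥ (s+3)^40`, a bound below `Γ(s)`. -/

namespace PartIneq

/-! ### Counting solutions of linear equations in two and three variables -/

/-- The solutions of `q * y + r * z = n` in natural numbers. -/
def pairSols (q r n : ℕ) : Finset (ℕ × ℕ) :=
  (Finset.range (n + 1) ×ˢ Finset.range (n + 1)).filter fun t => q * t.1 + r * t.2 = n

/-- The solutions of `p * x + q * y + r * z = n` in natural numbers. -/
def tripleSols (p q r n : ℕ) : Finset (ℕ × ℕ × ℕ) :=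
  (Finset.range (n + 1) ×ˢ Finset.range (n + 1) ×ˢ Finset.range (n + 1)).filter
    fun t => p * t.1 + q * t.2.1 + r * t.2.2 = n

lemma mem_pairSols {q r n : ℕ} (hq : 0 < q) (hr : 0 < r) {t : ℕ × ℕ} :
    t ∈ pairSols q r n ↔ q * t.1 + r * t.2 = n := by
  simp only [pairSols, Finset.mem_filter, Finset.mem_product, Finset.mem_range,
    and_iff_right_iff_imp]
  intro h
  constructor <;> nlinarith [Nat.zero_le t.1, Nat.zero_le t.2]

lemma mem_tripleSols {p q r n : ℕ} (hp : 0 < p) (hq : 0 < q) (hr : 0 < r) {t : ℕ × ℕ × ℕ} :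
    t ∈ tripleSols p q r n ↔ p * t.1 + q * t.2.1 + r * t.2.2 = n := by
  simp only [tripleSols, Finset.mem_filter, Finset.mem_product, Finset.mem_range,
    and_iff_right_iff_imp]
  intro h
  have h1 := Nat.le_mul_of_pos_left t.1 hp
  have h2 := Nat.le_mul_of_pos_left t.2.1 hq
  have h3 := Nat.le_mul_of_pos_left t.2.2 hr
  refine ⟨?_, ?_, ?_⟩ <;> omega

lemma card_tripleSols_rotate {p q r : ℕ} (hp : 0 < p) (hq : 0 < q) (hr : 0 < r) (n : ℕ) :
    (tripleSols p q r n).card = (tripleSols r p q n).card := by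
  refine Finset.card_nbij' (fun t => (t.2.2, t.1, t.2.1)) (fun t => (t.2.1, t.2.2, t.1))
    ?_ ?_ ?_ ?_
  · intro t ht
    simp only [Finset.mem_coe, mem_tripleSols hp hq hr, mem_tripleSols hr hp hq] at ht ⊢
    omega
  · intro t ht
    simp only [Finset.mem_coe, mem_tripleSols hp hq hr, mem_tripleSols hr hp hq] at ht ⊢
    omega
  · intro t _; rfl
  · intro t _; rfl

lemma card_tripleSols_le (p q r n : ℕ) (hp : 0 < p) (hq : 0 < q) (hr : 0 < r) :
    (tripleSols p q r n).card ≤ (n + 1) ^ 2 := by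
  have : (tripleSols p q r n).card ≤ (Finset.range (n + 1) ×ˢ Finset.range (n + 1)).card := by
    refine Finset.card_le_card_of_injOn (fun t => (t.1, t.2.1)) ?_ ?_
    · intro t ht
      simp only [tripleSols, Finset.coe_filter, Finset.mem_product, Set.mem_ofPred_eq] at ht
      simp only [Finset.coe_product, Set.mem_prod, Finset.mem_coe]
      exact ⟨ht.1.1, ht.1.2.1⟩
    · intro t ht t' ht' h
      rw [Finset.mem_coe, mem_tripleSols hp hq hr] at ht ht'
      simp only [Prod.mk.injEq] at h
      obtain ⟨x, y, z⟩ := t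
      obtain ⟨x', y', z'⟩ := t'
      simp only at ht ht' h
      obtain ⟨rfl, rfl⟩ := h
      have : r * z = r * z' := by omega
      simp [Nat.eq_of_mul_eq_mul_left hr this]
  simpa [sq] using this

/-- Coprimality fixes `y` modulo `r`, so `y / r` determines the solution, and `y ≤ n / q`. -/
lemma card_pairSols_le {q r : ℕ} (hq : 0 < q) (hr : 0 < r) (h : q.Coprime r) (n : ℕ) :
    (pairSols q r n).card ≤ n / (q * r) + 1 := by
  rw [← Finset.card_range (n / (q * r) + 1)]
  refine Finset.card_le_card_of_injOn (fun t => t.1 / r) ?_ ?_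
  · intro t ht
    rw [Finset.mem_coe, mem_pairSols hq hr] at ht
    simp only [Finset.coe_range, Set.mem_Iio, Nat.lt_succ_iff]
    rw [← Nat.div_div_eq_div_mul]
    apply Nat.div_le_div_right
    rw [Nat.le_div_iff_mul_le hq]
    nlinarith
  · intro t ht t' ht' e
    rw [Finset.mem_coe, mem_pairSols hq hr] at ht ht'
    simp only at e
    have hm : q * t.1 ≡ q * t'.1 [MOD r] := by
      have h1 : q * t.1 ≡ n [MOD r] := by
        rw [← ht]; exact (Nat.add_mul_mod_self_left _ _ _).symm
      have h2 : q * t'.1 ≡ n [MOD r] := by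
        rw [← ht']; exact (Nat.add_mul_mod_self_left _ _ _).symm
      exact h1.trans h2.symm
    have hm' : t.1 % r = t'.1 % r :=
      Nat.ModEq.cancel_left_of_coprime (by rw [Nat.gcd_comm]; exact h) hm
    have h1 : t.1 = t'.1 := by
      rw [← Nat.div_add_mod t.1 r, ← Nat.div_add_mod t'.1 r, e, hm']
    have h2 : r * t.2 = r * t'.2 := by rw [h1] at ht; omega
    exact Prod.ext h1 (Nat.eq_of_mul_eq_mul_left hr h2)

/-- From the least `y` in the right residue class modulo `r`, each of the steps `y + r * t` with `t
< n / (q * r)` still leaves a nonnegative multiple of `r`. -/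
lemma le_card_pairSols {q r : ℕ} (hq : 0 < q) (hr : 0 < r) (h : q.Coprime r) (n : ℕ) :
    n / (q * r) ≤ (pairSols q r n).card := by
  obtain ⟨y, hy, hyr⟩ : ∃ y, q * y ≡ n [MOD r] ∧ y < r := by
    obtain ⟨m, -, hm⟩ := Nat.exists_mul_mod_eq_of_coprime n h hr.ne'
    refine ⟨m % r, ?_, Nat.mod_lt _ hr⟩
    exact ((Nat.mod_modEq m r).mul_left q).trans hm
  have key : ∀ t < n / (q * r), q * (y + r * t) ≤ n ∧ r ∣ n - q * (y + r * t) := by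
    intro t ht
    have hle : q * (y + r * t) ≤ n := by
      have h1 : (t + 1) * (q * r) ≤ n :=
        (Nat.mul_le_mul_right _ ht).trans (Nat.div_mul_le_self _ _)
      nlinarith
    refine ⟨hle, (Nat.modEq_iff_dvd' hle).1 ?_⟩
    have : q * (y + r * t) = q * y + r * (q * t) := by ring
    rw [this]
    exact Nat.ModEq.trans (Nat.add_mul_mod_self_left _ _ _) hy
  conv_lhs => rw [← Finset.card_range (n / (q * r))]
  refine Finset.card_le_card_of_injOn
    (fun t => (y + r * t, (n - q * (y + r * t)) / r)) ?_ ?_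
  · intro t ht
    simp only [Finset.coe_range, Set.mem_Iio] at ht
    rw [Finset.mem_coe, mem_pairSols hq hr]
    simp only
    rw [Nat.mul_div_cancel' (key t ht).2]
    have := (key t ht).1
    omega
  · intro t _ t' _ e
    simp only [Prod.mk.injEq] at e
    have : r * t = r * t' := by omega
    exact Nat.eq_of_mul_eq_mul_left hr this

/-- Slicing by `x` and reversing the order makes the remainders `n - p * x` an increasing
progression starting at `n % p`. -/
lemma card_tripleSols_eq_sum {p q r : ℕ} (hp : 0 < p) (hq : 0 < q) (hr : 0 < r) (n : ℕ) :
    (tripleSols p q r n).card =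
      ∑ j ∈ Finset.range (n / p + 1), (pairSols q r (n % p + p * j)).card := by
  rw [← Finset.sum_range_reflect, Finset.card_eq_sum_card_fiberwise (f := Prod.fst)
    (t := Finset.range (n / p + 1))]
  · refine Finset.sum_congr rfl fun j hj => ?_
    rw [Finset.mem_range, Nat.lt_succ_iff] at hj
    have hn : n % p + p * (n / p + 1 - 1 - j) + p * j = n := by
      have h1 := Nat.mod_add_div n p
      have h2 : p * (n / p + 1 - 1 - j) + p * j = p * (n / p) := by
        rw [← mul_add]; congr 1; omega
      omega
    refine Finset.card_nbij' (fun t => t.2) (fun t => (j, t)) ?_ ?_ ?_ ?_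
    · intro t ht
      simp only [Finset.coe_filter, Set.mem_ofPred_eq, Finset.mem_coe, mem_tripleSols hp hq hr,
        mem_pairSols hq hr] at ht ⊢
      obtain ⟨h1, rfl⟩ := ht
      omega
    · intro t ht
      simp only [Finset.coe_filter, Set.mem_ofPred_eq, Finset.mem_coe, mem_tripleSols hp hq hr,
        mem_pairSols hq hr] at ht ⊢
      exact ⟨by omega, trivial⟩
    · intro t ht
      simp only [Finset.coe_filter, Set.mem_ofPred_eq] at ht
      exact Prod.ext ht.2.symm rfl
    · intro t _; rfl
  · intro t ht
    rw [Finset.mem_coe, mem_tripleSols hp hq hr] at ht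
    rw [Finset.mem_coe, Finset.mem_range, Nat.lt_succ_iff, Nat.le_div_iff_mul_le hp, mul_comm]
    omega

lemma two_mul_sum_arith (e p J : ℕ) :
    2 * ∑ j ∈ Finset.range (J + 1), (e + p * j) = (J + 1) * (2 * e + p * J) := by
  induction J with
  | zero => simp
  | succ J ih => rw [Finset.sum_range_succ, mul_add, ih]; ring

lemma card_tripleSols_upper {p q r : ℕ} (hp : 0 < p) (hq : 0 < q) (hr : 0 < r)
    (h : q.Coprime r) (n : ℕ) :
    2 * p * q * r * (tripleSols p q r n).card ≤
      n ^ 2 + 2 * p * n + 2 * q * r * (n + p) := by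
  rw [card_tripleSols_eq_sum hp hq hr]
  have h1 : q * r * ∑ j ∈ Finset.range (n / p + 1), (pairSols q r (n % p + p * j)).card ≤
      ∑ j ∈ Finset.range (n / p + 1), (n % p + p * j) + q * r * (n / p + 1) := by
    rw [Finset.mul_sum]
    have : q * r * (n / p + 1) = ∑ _j ∈ Finset.range (n / p + 1), q * r := by
      simp [mul_comm]
    rw [this, ← Finset.sum_add_distrib]
    refine Finset.sum_le_sum fun j _ => ?_
    calc _ ≤ q * r * ((n % p + p * j) / (q * r) + 1) :=
          Nat.mul_le_mul_left _ (card_pairSols_le hq hr h _)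
      _ ≤ _ := by rw [mul_add, mul_one]; gcongr; exact Nat.mul_div_le _ _
  have h2 := two_mul_sum_arith (n % p) p (n / p)
  have h3 := Nat.mod_add_div n p
  have h4 := Nat.mod_lt n hp
  have h5 := Nat.mod_le n p
  generalize (∑ j ∈ Finset.range (n / p + 1), (pairSols q r (n % p + p * j)).card) = T at *
  generalize (∑ j ∈ Finset.range (n / p + 1), (n % p + p * j)) = S at *
  generalize n / p = J at *
  generalize n % p = e at *
  -- The arithmetic series, with `p * J = n - e`, cleared of denominators.
  have h6 : 2 * p * S = (n - e + p) * (n + e) := by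
    have : n - e = p * J := by omega
    rw [this, ← h3]; linear_combination p * h2
  have h7 : 2 * p * q * r * T ≤ 2 * p * S + 2 * q * r * (p * J + p) := by
    calc 2 * p * q * r * T = 2 * p * (q * r * T) := by ring
      _ ≤ 2 * p * (S + q * r * (J + 1)) := Nat.mul_le_mul_left _ h1
      _ = _ := by ring
  have h8 : (n - e + p) * (n + e) ≤ n ^ 2 + 2 * p * n := by
    zify [h5] at h4 ⊢
    nlinarith [mul_nonneg (Int.natCast_nonneg e) (Int.natCast_nonneg p),
      mul_nonneg (Int.natCast_nonneg e) (Int.natCast_nonneg e),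
      mul_le_mul_of_nonneg_right (Int.ofNat_le.2 h5) (Int.natCast_nonneg p)]
  have h9 : 2 * q * r * (p * J + p) ≤ 2 * q * r * (n + p) :=
    Nat.mul_le_mul_left _ (by omega)
  omega

lemma card_tripleSols_lower {p q r : ℕ} (hp : 0 < p) (hq : 0 < q) (hr : 0 < r)
    (h : q.Coprime r) (n : ℕ) :
    n ^ 2 ≤ 2 * p * q * r * (tripleSols p q r n).card + 2 * q * r * (n + p) := by
  rw [card_tripleSols_eq_sum hp hq hr]
  have h1 : ∑ j ∈ Finset.range (n / p + 1), (n % p + p * j) ≤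
      q * r * ∑ j ∈ Finset.range (n / p + 1), (pairSols q r (n % p + p * j)).card
        + q * r * (n / p + 1) := by
    rw [Finset.mul_sum]
    have : q * r * (n / p + 1) = ∑ _j ∈ Finset.range (n / p + 1), q * r := by
      simp [mul_comm]
    rw [this, ← Finset.sum_add_distrib]
    refine Finset.sum_le_sum fun j _ => ?_
    calc n % p + p * j ≤ q * r * ((n % p + p * j) / (q * r) + 1) :=
          (Nat.lt_mul_div_succ _ (Nat.mul_pos hq hr)).le
      _ ≤ _ := by rw [mul_add, mul_one]; gcongr; exact le_card_pairSols hq hr h _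
  have h2 := two_mul_sum_arith (n % p) p (n / p)
  have h3 := Nat.mod_add_div n p
  have h4 := Nat.mod_lt n hp
  have h5 := Nat.mod_le n p
  generalize (∑ j ∈ Finset.range (n / p + 1), (pairSols q r (n % p + p * j)).card) = T at *
  generalize (∑ j ∈ Finset.range (n / p + 1), (n % p + p * j)) = S at *
  generalize n / p = J at *
  generalize n % p = e at *
  have h6 : 2 * p * S = (n - e + p) * (n + e) := by
    have : n - e = p * J := by omega
    rw [this, ← h3]; linear_combination p * h2
  have h7 : 2 * p * S ≤ 2 * p * q * r * T + 2 * q * r * (p * J + p) := by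
    calc 2 * p * S ≤ 2 * p * (q * r * T + q * r * (J + 1)) := Nat.mul_le_mul_left _ h1
      _ = _ := by ring
  have h8 : n ^ 2 ≤ (n - e + p) * (n + e) := by
    zify [h5] at h4 ⊢
    nlinarith [mul_nonneg (Int.natCast_nonneg e) (sub_nonneg.2 h4.le),
      mul_nonneg (Int.natCast_nonneg n) (Int.natCast_nonneg p)]
  have h9 : 2 * q * r * (p * J + p) ≤ 2 * q * r * (n + p) :=
    Nat.mul_le_mul_left _ (by omega)
  omega

lemma le_card_filter_tripleSols {p q r : ℕ} (hp : 0 < p) (hq : 0 < q) (hr : 0 < r) {n : ℕ}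
    (hn : p ≤ n) :
    (tripleSols p q r (n - p)).card ≤ ((tripleSols p q r n).filter fun t => 1 ≤ t.1).card := by
  refine Finset.card_le_card_of_injOn (fun t => (t.1 + 1, t.2)) ?_ ?_
  · intro t ht
    rw [Finset.mem_coe, mem_tripleSols hp hq hr] at ht
    rw [Finset.mem_coe, Finset.mem_filter, mem_tripleSols hp hq hr]
    simp only [mul_add]
    omega
  · intro t _ t' _ e
    simp only [Prod.mk.injEq, add_left_inj] at e
    exact Prod.ext e.1 e.2

lemma sq_le_of_sub {n s : ℕ} (hn : s ≤ n) : n ^ 2 ≤ (n - s) ^ 2 + 2 * s * n := by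
  zify [hn]
  nlinarith [sq_nonneg (s : ℤ)]

lemma sq_le_card_filter_tripleSols {p q r : ℕ} (hp : 0 < p) (hq : 0 < q) (hr : 0 < r)
    (h : q.Coprime r) (n : ℕ) :
    n ^ 2 ≤ 2 * p * q * r * ((tripleSols p q r n).filter fun t => 1 ≤ t.1).card +
      (2 * q * r + 2 * p) * n := by
  rcases lt_or_ge n p with hn | hn
  · nlinarith [Nat.zero_le (2 * q * r * n),
      Nat.zero_le (2 * p * q * r * ((tripleSols p q r n).filter fun t => 1 ≤ t.1).card)]
  · have h1 := card_tripleSols_lower hp hq hr h (n - p)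
    have h2 := Nat.mul_le_mul_left (2 * p * q * r) (le_card_filter_tripleSols hp hq hr hn)
    have h3 := sq_le_of_sub hn
    rw [Nat.sub_add_cancel hn] at h1
    nlinarith

/-- Slicing by `z` instead needs only `p` and `q` coprime, at the price of a larger linear error. -/
lemma sq_le_card_filter_tripleSols_rotate {p q r : ℕ} (hp : 0 < p) (hq : 0 < q) (hr : 0 < r)
    (h : p.Coprime q) {n : ℕ} (hn : 0 < n) :
    n ^ 2 ≤ 2 * p * q * r * ((tripleSols p q r n).filter fun t => 1 ≤ t.1).card +
      (2 * p * q * (1 + r) + 2 * p) * n := by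
  rcases lt_or_ge n p with hn' | hn'
  · nlinarith [Nat.zero_le (2 * p * q * (1 + r) * n),
      Nat.zero_le (2 * p * q * r * ((tripleSols p q r n).filter fun t => 1 ≤ t.1).card)]
  · have h1 := card_tripleSols_lower hr hp hq h (n - p)
    rw [← card_tripleSols_rotate hp hq hr] at h1
    have h2 := Nat.mul_le_mul_left (2 * p * q * r) (le_card_filter_tripleSols hp hq hr hn')
    have h3 := sq_le_of_sub hn'
    have h4 : 2 * p * q * (n - p + r) ≤ 2 * p * q * (1 + r) * n := by
      rw [mul_assoc (2 * p * q)]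
      apply Nat.mul_le_mul_left
      have : r ≤ r * n := Nat.le_mul_of_pos_right r hn
      rw [add_mul]; omega
    nlinarith

/-! ### Quadratic surplus of `s, a, b` over `k, a, b` -/

/-- Comparison of the number of representations of `n` by `s, a, b` with `s` used and the number
of its representations by `k, a, b`. -/
lemma sq_add_card_le {s a b k n : ℕ} (hs : 0 < s) (ha : 0 < a) (hb : 0 < b) (hk : s + 1 ≤ k)
    (has : a ≤ s + 3) (hbs : b ≤ s + 3) (hn : 0 < n)
    (h : a.Coprime b ∨ (a = s + 1 ∧ b = s + 3 ∧ k = s + 2)) :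
    n ^ 2 + 2 * a * b * s * (s + 1) * (tripleSols k a b n).card ≤
      2 * a * b * s * (s + 1) * ((tripleSols s a b n).filter fun t => 1 ≤ t.1).card +
        10 * (s + 3) ^ 4 * n := by
  have hk0 : 0 < k := by omega
  rcases h with h | ⟨rfl, rfl, rfl⟩
  · have h1 := sq_le_card_filter_tripleSols hs ha hb h n
    have h2 := card_tripleSols_upper hk0 ha hb h n
    generalize ((tripleSols s a b n).filter fun t => 1 ≤ t.1).card = c at *
    generalize (tripleSols k a b n).card = d at *
    have hab : a * b ≤ (s + 3) ^ 2 := by rw [sq]; exact Nat.mul_le_mul has hbs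
    have h3 : (s + 1) * (2 * a * b * d) ≤
        n ^ 2 + 2 * a * b * n + (s + 1) * (2 * n + 2 * a * b) := by
      have h2' : k * (2 * a * b * d) ≤ n ^ 2 + 2 * a * b * n + k * (2 * n + 2 * a * b) := by
        nlinarith
      -- Replacing `k` by `s + 1` in `h2'` is legitimate when the difference of the two sides
      -- multiplied by `k` is nonnegative; otherwise the claim is immediate.
      rcases le_total (2 * a * b * d) (2 * n + 2 * a * b) with h4 | h4
      · exact (Nat.mul_le_mul_left _ h4).trans (Nat.le_add_left _ _)
      · obtain ⟨m, hm⟩ := Nat.exists_eq_add_of_le h4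
        rw [hm, mul_add] at h2' ⊢
        have := Nat.mul_le_mul_right m hk
        omega
    have h4 := Nat.mul_le_mul_left s h3
    have h5 := Nat.mul_le_mul_left (s + 1) h1
    have h6 : (s + 1) * ((2 * a * b + 2 * s) * n) + s * (2 * a * b * n + (s + 1) * (2 * n + 2 * a * b))
        ≤ 10 * (s + 3) ^ 4 * n := by
      have h7 : a * b * 1 ≤ (s + 3) ^ 2 * n := Nat.mul_le_mul hab hn
      have h8 : a * b * n ≤ (s + 3) ^ 2 * n := Nat.mul_le_mul_right n hab
      calc _ = (s + 1) * (2 * (a * b * n)) + (s + 1) * (2 * s) * n + 2 * s * (a * b * n)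
              + 2 * s * (s + 1) * n + 2 * s * (s + 1) * (a * b * 1) := by ring
        _ ≤ (s + 1) * (2 * ((s + 3) ^ 2 * n)) + (s + 1) * (2 * s) * n + 2 * s * ((s + 3) ^ 2 * n)
              + 2 * s * (s + 1) * n + 2 * s * (s + 1) * ((s + 3) ^ 2 * n) := by gcongr
        _ = ((s + 1) * (2 * (s + 3) ^ 2) + (s + 1) * (2 * s) + 2 * s * (s + 3) ^ 2
              + 2 * s * (s + 1) + 2 * s * (s + 1) * (s + 3) ^ 2) * n := by ring
        _ ≤ _ := by
          apply Nat.mul_le_mul_right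
          ring_nf; nlinarith [Nat.zero_le s]
    nlinarith
  -- Here `s + 1` and `s + 3` may both be even, so the coprime pairs used are `s, s + 1` and `s + 2,
  -- s + 1`.
  · have h1 := sq_le_card_filter_tripleSols_rotate hs ha hb (by simp) hn
    have h2 := card_tripleSols_upper hb hk0 ha (by
      rw [show s + 2 = (s + 1) + 1 by ring]; simp) n
    rw [← card_tripleSols_rotate hk0 ha hb] at h2
    generalize ((tripleSols s (s + 1) (s + 3) n).filter fun t => 1 ≤ t.1).card = c at *
    generalize (tripleSols (s + 2) (s + 1) (s + 3) n).card = d at *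
    have h3 : (s + 1) * (2 * (s + 1) * (s + 3) * d) ≤
        n ^ 2 + (2 * (s + 3) + 2 * (s + 2) * (s + 1) * (s + 4)) * n := by
      calc _ ≤ (s + 2) * (2 * (s + 1) * (s + 3) * d) := Nat.mul_le_mul_right _ hk
        _ = 2 * (s + 3) * (s + 2) * (s + 1) * d := by ring
        _ ≤ _ := h2
        _ ≤ n ^ 2 + 2 * (s + 3) * n + 2 * (s + 2) * (s + 1) * (n + (s + 3) * n) := by
          gcongr; exact Nat.le_mul_of_pos_right _ hn
        _ = _ := by ring
    have h4 := Nat.mul_le_mul_left s h3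
    have h5 := Nat.mul_le_mul_left (s + 1) h1
    have h6 : (s + 1) * (2 * s * (s + 1) * (1 + (s + 3)) + 2 * s) +
        s * (2 * (s + 3) + 2 * (s + 2) * (s + 1) * (s + 4)) ≤ 10 * (s + 3) ^ 4 := by
      ring_nf; nlinarith [Nat.zero_le s]
    have h7 := Nat.mul_le_mul_right n h6
    nlinarith

/-! ### Compensating deficits by transport between multisets -/

/-- If the terms with `w x < n₀` can be moved to terms with `n₁ ≤ w x` so that at most `w y` of
them land on `y`, then a surplus of `K * w y` at those `y` makes up for a deficit of at most `K`
at each of the terms moved. -/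
lemma sum_le_sum_of_transport {α : Type*} [DecidableEq α] (R : Finset α) (w : α → ℕ) (c d : ℕ → ℕ)
    (n₀ n₁ K : ℕ) (h01 : n₀ ≤ n₁)
    (hmid : ∀ n, n₀ ≤ n → d n ≤ c n) (hlow : ∀ n < n₀, d n ≤ K)
    (hhigh : ∀ n, n₁ ≤ n → d n + K * n ≤ c n) (φ : α → α)
    (hφ : ∀ x ∈ R, w x < n₀ → φ x ∈ R ∧ n₁ ≤ w (φ x))
    (hcard : ∀ y ∈ R, {x ∈ R | w x < n₀ ∧ φ x = y}.card ≤ w y) :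
    ∑ x ∈ R, d (w x) ≤ ∑ x ∈ R, c (w x) := by
  have hbad : {x ∈ R | w x < n₀}.card ≤ ∑ y ∈ R with n₁ ≤ w y, w y := by
    rw [Finset.card_eq_sum_card_fiberwise (f := φ) (t := {y ∈ R | n₁ ≤ w y})]
    · refine Finset.sum_le_sum fun y hy => ?_
      rw [Finset.filter_filter]
      exact hcard y (Finset.mem_filter.1 hy).1
    · intro x hx
      simp only [Finset.coe_filter, Set.mem_ofPred_eq] at hx ⊢
      exact hφ x hx.1 hx.2
  have h1 : ∀ x ∈ R, d (w x) + K * (if n₁ ≤ w x then w x else 0) ≤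
      c (w x) + K * (if w x < n₀ then 1 else 0) := by
    intro x _
    rcases lt_or_ge (w x) n₀ with h | h
    · rw [if_neg (by omega), if_pos h]
      have := hlow _ h
      omega
    · rw [if_neg (not_lt.2 h)]
      split_ifs with h'
      · simpa using hhigh _ h'
      · simpa using hmid _ h
  have h2 := Finset.sum_le_sum h1
  rw [Finset.sum_add_distrib, Finset.sum_add_distrib, ← Finset.mul_sum, ← Finset.mul_sum,
    ← Finset.sum_filter, ← Finset.sum_filter, ← Finset.card_eq_sum_ones] at h2
  have := Nat.mul_le_mul_left K hbad
  omega

/-- The multisets of sum at most `N` with all elements in `W` (for a set `W` of positive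
integers). -/
def boundedMultisets (W : Finset ℕ) (N : ℕ) : Finset (Multiset ℕ) :=
  ((Finset.range (N + 1)).biUnion fun m =>
    (Finset.univ : Finset (Nat.Partition m)).image Nat.Partition.parts).filter
      fun ρ => ∀ i ∈ ρ, i ∈ W

lemma mem_boundedMultisets {W : Finset ℕ} (hW : ∀ i ∈ W, 0 < i) {N : ℕ} {ρ : Multiset ℕ} :
    ρ ∈ boundedMultisets W N ↔ (∀ i ∈ ρ, i ∈ W) ∧ ρ.sum ≤ N := by
  simp only [boundedMultisets, Finset.mem_filter, Finset.mem_biUnion, Finset.mem_range,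
    Finset.mem_image, Finset.mem_univ, true_and]
  constructor
  · rintro ⟨⟨m, hm, p, rfl⟩, h⟩
    exact ⟨h, by rw [p.parts_sum]; omega⟩
  · rintro ⟨h, hN⟩
    exact ⟨⟨ρ.sum, by omega, ⟨ρ, fun {i} hi => hW i (h i hi), rfl⟩, rfl⟩, h⟩

/-- Otherwise all elements are less than `n` and each value contributes less than `n` in total. -/
lemma exists_le_mul_count {ρ : Multiset ℕ} {n : ℕ} (h : n ^ 2 < ρ.sum) :
    ∃ i ∈ ρ, n ≤ i * ρ.count i := by
  by_contra! hc
  have hsub : ρ.toFinset ⊆ Finset.range n := by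
    intro i hi
    rw [Multiset.mem_toFinset] at hi
    have h1 := hc i hi
    have h2 := Nat.le_mul_of_pos_right i (Multiset.count_pos.2 hi)
    exact Finset.mem_range.2 (by omega)
  have : ρ.sum ≤ n ^ 2 := by
    rw [Finset.sum_multiset_count]
    calc _ ≤ ∑ _i ∈ ρ.toFinset, n := by
          refine Finset.sum_le_sum fun i hi => ?_
          rw [smul_eq_mul, mul_comm]
          exact (hc i (Multiset.mem_toFinset.1 hi)).le
      _ = ρ.toFinset.card * n := by simp
      _ ≤ n * n := Nat.mul_le_mul_right _ (by simpa using Finset.card_le_card hsub)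
      _ = n ^ 2 := (sq n).symm
  omega

/-- Removing about `n₁` worth of copies of a frequent element from the multisets of sum close
to `N`. -/
lemma exists_transport {W : Finset ℕ} (hW : ∀ i ∈ W, 0 < i) {N n₀ n₁ : ℕ} (hn₁ : 0 < n₁)
    (hN : n₁ ^ 2 + n₀ ≤ N) :
    ∃ φ : Multiset ℕ → Multiset ℕ,
      (∀ x ∈ boundedMultisets W N, N - x.sum < n₀ →
        φ x ∈ boundedMultisets W N ∧ n₁ ≤ N - (φ x).sum) ∧
      ∀ y ∈ boundedMultisets W N,
        {x ∈ boundedMultisets W N | N - x.sum < n₀ ∧ φ x = y}.card ≤ N - y.sum := by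
  have hex : ∀ x : Multiset ℕ, ∃ i : ℕ, x ∈ boundedMultisets W N → N - x.sum < n₀ →
      i ∈ x ∧ n₁ ≤ i * x.count i := by
    intro x
    by_cases hx : x ∈ boundedMultisets W N ∧ N - x.sum < n₀
    · obtain ⟨hx, hn⟩ := hx
      rw [mem_boundedMultisets hW] at hx
      obtain ⟨i, hi⟩ := exists_le_mul_count (ρ := x) (n := n₁) (by omega)
      exact ⟨i, fun _ _ => hi⟩
    · exact ⟨0, fun h1 h2 => absurd ⟨h1, h2⟩ hx⟩
  choose g hg using hex
  -- The number of copies is `n₁ / i` rounded up: the fewest with total at least `n₁`. It is at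
  -- least one, so the total is also at least `i`.
  let r : ℕ → Multiset ℕ := fun i => Multiset.replicate ((n₁ + i - 1) / i) i
  have hr : ∀ x ∈ boundedMultisets W N, N - x.sum < n₀ →
      0 < g x ∧ n₁ ≤ (r (g x)).sum ∧ g x ≤ (r (g x)).sum ∧ x - r (g x) + r (g x) = x := by
    intro x hx hn
    obtain ⟨h1, h2⟩ := hg x hx hn
    have h0 : 0 < g x := hW _ (((mem_boundedMultisets hW).1 hx).1 _ h1)
    have hq : 0 < (n₁ + g x - 1) / g x := Nat.div_pos (by omega) h0
    refine ⟨h0, ?_, ?_, Multiset.sub_add_cancel ?_⟩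
    · have := Nat.lt_div_mul_add (a := n₁ + g x - 1) h0
      simp only [r, Multiset.sum_replicate, smul_eq_mul]
      omega
    · simp only [r, Multiset.sum_replicate, smul_eq_mul]
      exact Nat.le_mul_of_pos_left _ hq
    · rw [← Multiset.le_count_iff_replicate_le, ← Nat.lt_succ_iff, Nat.div_lt_iff_lt_mul h0,
        Nat.succ_mul, mul_comm]
      omega
  refine ⟨fun x => x - r (g x), fun x hx hn => ?_, fun y hy => ?_⟩
  · obtain ⟨-, h1, -, h2⟩ := hr x hx hn
    rw [mem_boundedMultisets hW] at hx ⊢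
    have h3 := congrArg Multiset.sum h2
    rw [Multiset.sum_add] at h3
    refine ⟨⟨fun i hi => hx.1 i (Multiset.mem_of_le (Multiset.sub_le_self _ _) hi), ?_⟩, ?_⟩ <;>
      simp only <;> omega
  · have : N - y.sum = (Finset.Icc 1 (N - y.sum)).card := by simp
    rw [this]
    -- A preimage of `y` is `y + r (g x)`, hence determined by `g x`, which is at most the sum
    -- removed and so at most `N - y.sum`.
    refine Finset.card_le_card_of_injOn g ?_ ?_
    · intro x hx
      simp only [Finset.coe_filter, Set.mem_ofPred_eq] at hx
      obtain ⟨hx, hn, rfl⟩ := hx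
      obtain ⟨h0, -, h1, h2⟩ := hr x hx hn
      have h3 := congrArg Multiset.sum h2
      rw [Multiset.sum_add] at h3
      have h4 := ((mem_boundedMultisets hW).1 hx).2
      rw [Finset.mem_coe, Finset.mem_Icc]
      omega
    · intro x hx x' hx' e
      simp only [Finset.coe_filter, Set.mem_ofPred_eq] at hx hx'
      rw [← (hr x hx.1 hx.2.1).2.2.2, ← (hr x' hx'.1 hx'.2.1).2.2.2, hx.2.2, hx'.2.2, e]

/-! ### Partitions as other parts plus three multiplicities -/

/-- The multiset with `x, y, z` copies of `k, a, b`. -/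
def tripleMultiset (k a b : ℕ) (t : ℕ × ℕ × ℕ) : Multiset ℕ :=
  Multiset.replicate t.1 k + Multiset.replicate t.2.1 a + Multiset.replicate t.2.2 b

lemma sum_tripleMultiset (k a b : ℕ) (t : ℕ × ℕ × ℕ) :
    (tripleMultiset k a b t).sum = k * t.1 + a * t.2.1 + b * t.2.2 := by
  simp [tripleMultiset, mul_comm]

lemma mem_of_mem_tripleMultiset {k a b : ℕ} {t : ℕ × ℕ × ℕ} {i : ℕ}
    (h : i ∈ tripleMultiset k a b t) : i = k ∨ i = a ∨ i = b := by
  simp only [tripleMultiset, Multiset.mem_add, Multiset.mem_replicate] at h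
  tauto

lemma filter_add_tripleMultiset {W : Finset ℕ} {k a b : ℕ} (hk : k ∉ W) (ha : a ∉ W) (hb : b ∉ W)
    (hka : k ≠ a) (hkb : k ≠ b) (hab : a ≠ b) {M : Multiset ℕ}
    (hM : ∀ i ∈ M, i ∈ W ∨ i = k ∨ i = a ∨ i = b) :
    M.filter (· ∈ W) + tripleMultiset k a b (M.count k, M.count a, M.count b) = M := by
  ext i
  simp only [tripleMultiset, Multiset.count_add, Multiset.count_filter, Multiset.count_replicate]
  by_cases hi : i ∈ M
  · rcases hM i hi with h | rfl | rfl | rfl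
    · have h1 : k ≠ i := by rintro rfl; exact hk h
      have h2 : a ≠ i := by rintro rfl; exact ha h
      have h3 : b ≠ i := by rintro rfl; exact hb h
      simp [h, h1, h2, h3]
    · simp [hk, hka.symm, hkb.symm]
    · simp [ha, hka, hab.symm]
    · simp [hb, hkb, hab]
  · rw [← Multiset.count_eq_zero] at hi
    split_ifs <;> simp_all

lemma tripleMultiset_injective {k a b : ℕ} (hka : k ≠ a) (hkb : k ≠ b) (hab : a ≠ b) :
    Function.Injective (tripleMultiset k a b) := by
  rintro ⟨x, y, z⟩ ⟨x', y', z'⟩ h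
  have h1 := congrArg (Multiset.count k) h
  have h2 := congrArg (Multiset.count a) h
  have h3 := congrArg (Multiset.count b) h
  simp [tripleMultiset, Multiset.count_replicate, hka.symm, hkb.symm, hab.symm, hka, hkb,
    hab] at h1 h2 h3
  simp [h1, h2, h3]

section Fibres

variable {L s k a b N : ℕ}

/-- The parts in `{s+1, …, L+s}` other than `k`, `a` and `b`. -/
def otherParts (L s k a b : ℕ) : Finset ℕ :=
  (Finset.Icc (s + 1) (L + s)).filter fun i => i ≠ k ∧ i ≠ a ∧ i ≠ b

lemma mem_otherParts {i : ℕ} :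
    i ∈ otherParts L s k a b ↔ (s + 1 ≤ i ∧ i ≤ L + s) ∧ i ≠ k ∧ i ≠ a ∧ i ≠ b := by
  simp [otherParts]

lemma card_partsD_le (hk : 0 < k) (ha : 0 < a) (hb : 0 < b)
    (hka : k ≠ a) (hkb : k ≠ b) (hab : a ≠ b) :
    (partsD L s N).card ≤ ∑ ρ ∈ boundedMultisets (otherParts L s k a b) N,
      (tripleSols k a b (N - ρ.sum)).card := by
  have hW : ∀ i ∈ otherParts L s k a b, 0 < i := fun i hi => by
    rw [mem_otherParts] at hi; omega
  have hdec : ∀ p ∈ partsD L s N, p.parts.filter (· ∈ otherParts L s k a b) +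
      tripleMultiset k a b (p.parts.count k, p.parts.count a, p.parts.count b) = p.parts := by
    intro p hp
    simp only [partsD, Finset.mem_filter] at hp
    refine filter_add_tripleMultiset ?_ ?_ ?_ hka hkb hab ?_
    · simp [mem_otherParts]
    · simp [mem_otherParts]
    · simp [mem_otherParts]
    · intro i hi
      have := hp.2.2 i hi
      rw [mem_otherParts]
      tauto
  have hsum : ∀ p ∈ partsD L s N, (p.parts.filter (· ∈ otherParts L s k a b)).sum +
      (k * p.parts.count k + a * p.parts.count a + b * p.parts.count b) = N := by
    intro p hp
    have h := congrArg Multiset.sum (hdec p hp)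
    rwa [Multiset.sum_add, sum_tripleMultiset, p.parts_sum] at h
  rw [Finset.card_eq_sum_card_fiberwise
    (f := fun p : Nat.Partition N => p.parts.filter (· ∈ otherParts L s k a b))
    (t := boundedMultisets (otherParts L s k a b) N)]
  · refine Finset.sum_le_sum fun ρ _ => ?_
    refine Finset.card_le_card_of_injOn
      (fun p => (p.parts.count k, p.parts.count a, p.parts.count b)) ?_ ?_
    · intro p hp
      simp only [Finset.coe_filter, Set.mem_ofPred_eq] at hp
      obtain ⟨hp, rfl⟩ := hp
      rw [Finset.mem_coe, mem_tripleSols hk ha hb]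
      have := hsum p hp
      simp only
      omega
    · intro p hp p' hp' e
      simp only [Finset.coe_filter, Set.mem_ofPred_eq] at hp hp' e
      apply Nat.Partition.ext
      rw [← hdec p hp.1, ← hdec p' hp'.1, hp.2, hp'.2, e]
  · intro p hp
    rw [Finset.mem_coe, mem_boundedMultisets hW]
    exact ⟨fun i hi => (Multiset.mem_filter.1 hi).2, Nat.le.intro (hsum p hp)⟩

/-- Adjoining the copies of `s, a, b` to `ρ` is injective: none of these lies in `otherParts`, so
filtering recovers `ρ`. -/
lemma le_card_partsI (hs : 0 < s) (hk : s < k) (ha : s < a) (haL : a ≤ L + s) (hb : s < b)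
    (hbL : b ≤ L + s) (hka : k ≠ a) (hkb : k ≠ b) (hab : a ≠ b) :
    ∑ ρ ∈ boundedMultisets (otherParts L s k a b) N,
      ((tripleSols s a b (N - ρ.sum)).filter fun t => 1 ≤ t.1).card ≤ (partsI L s k N).card := by
  have hW : ∀ i ∈ otherParts L s k a b, 0 < i := fun i hi => by
    rw [mem_otherParts] at hi; omega
  rw [← Finset.card_sigma]
  have hsol : ∀ x ∈ (boundedMultisets (otherParts L s k a b) N).sigma
      fun ρ => (tripleSols s a b (N - ρ.sum)).filter fun t => 1 ≤ t.1,
      (∀ i ∈ x.1, i ∈ otherParts L s k a b) ∧ (x.1 + tripleMultiset s a b x.2).sum = N ∧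
        1 ≤ x.2.1 := by
    intro x hx
    rw [Finset.mem_sigma, mem_boundedMultisets hW, Finset.mem_filter,
      mem_tripleSols hs (by omega) (by omega)] at hx
    obtain ⟨⟨h1, h2⟩, h3, h4⟩ := hx
    refine ⟨h1, ?_, h4⟩
    rw [Multiset.sum_add, sum_tripleMultiset]
    omega
  have hpos : ∀ x ∈ (boundedMultisets (otherParts L s k a b) N).sigma
      fun ρ => (tripleSols s a b (N - ρ.sum)).filter fun t => 1 ≤ t.1,
      ∀ i ∈ x.1 + tripleMultiset s a b x.2, s ≤ i ∧ i ≤ L + s ∧ i ≠ k := by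
    intro x hx i hi
    rcases Multiset.mem_add.1 hi with h | h
    · have := (hsol x hx).1 i h
      rw [mem_otherParts] at this
      omega
    · have := mem_of_mem_tripleMultiset h
      omega
  refine Finset.card_le_card_of_forall_subsingleton
    (fun x p => x.1 + tripleMultiset s a b x.2 = p.parts) (fun x hx => ?_) (fun p _ => ?_)
  · refine ⟨⟨x.1 + tripleMultiset s a b x.2, fun {i} hi => ?_, (hsol x hx).2.1⟩, ?_, rfl⟩
    · have := hpos x hx i hi
      omega
    · simp only [partsI, Finset.mem_filter, Finset.mem_univ, true_and]
      refine ⟨?_, fun i hi => (hpos x hx i hi).1, fun i hi => (hpos x hx i hi).2.1,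
        fun hk' => (hpos x hx k hk').2.2 rfl⟩
      have := (hsol x hx).2.2
      simp only [tripleMultiset, Multiset.mem_add, Multiset.mem_replicate]
      exact Or.inr (Or.inl (Or.inl ⟨by omega, trivial⟩))
  · rintro ⟨ρ, t⟩ ⟨hx, e⟩ ⟨ρ', t'⟩ ⟨hx', e'⟩
    simp only at e e'
    have hf : ∀ x ∈ (boundedMultisets (otherParts L s k a b) N).sigma
        fun ρ => (tripleSols s a b (N - ρ.sum)).filter fun t => 1 ≤ t.1,
        (x.1 + tripleMultiset s a b x.2).filter (· ∈ otherParts L s k a b) = x.1 := by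
      intro x hx
      rw [Multiset.filter_add, Multiset.filter_eq_self.2 (hsol x hx).1,
        Multiset.filter_eq_nil.2, add_zero]
      intro i hi
      rw [mem_otherParts]
      have := mem_of_mem_tripleMultiset hi
      omega
    have h1 : ρ = ρ' := by
      have h := hf _ hx
      have h' := hf _ hx'
      simp only at h h'
      rw [e] at h
      rw [e'] at h'
      exact h.symm.trans h'
    subst h1
    have h2 : t = t' := by
      apply tripleMultiset_injective (k := s) (a := a) (b := b) (by omega) (by omega) hab
      exact add_left_cancel (e.trans e'.symm)
    rw [h2]

end Fibres

/-! ### Explicit constants and conclusion -/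

/-- With `h = s + 3`, `E = 10 * h ^ 4` and `G ≤ 2 * h ^ 4`, this bounds the threshold `(E + G * E ^
2) ^ 2 + E` of the transport argument. -/
lemma bound_le_pow_forty {h : ℕ} (hh : 4 ≤ h) :
    (10 * h ^ 4 + 2 * h ^ 4 * (10 * h ^ 4) ^ 2) ^ 2 + 10 * h ^ 4 ≤ h ^ 40 := by
  have h16 : 16 ≤ h ^ 2 := by nlinarith
  have hE : 10 * h ^ 4 ≤ h ^ 6 := by
    calc 10 * h ^ 4 ≤ h ^ 2 * h ^ 4 := Nat.mul_le_mul_right _ (by omega)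
      _ = h ^ 6 := by ring
  have hn : 10 * h ^ 4 + 2 * h ^ 4 * (10 * h ^ 4) ^ 2 ≤ h ^ 18 := by
    calc 10 * h ^ 4 + 2 * h ^ 4 * (10 * h ^ 4) ^ 2 ≤ h ^ 6 + 2 * h ^ 4 * (h ^ 6) ^ 2 := by gcongr
      _ = h ^ 6 + 2 * h ^ 16 := by ring
      _ ≤ h ^ 16 + 2 * h ^ 16 :=
        Nat.add_le_add_right (Nat.pow_le_pow_right (by omega) (by norm_num)) _
      _ = 3 * h ^ 16 := by ring
      _ ≤ h ^ 2 * h ^ 16 := Nat.mul_le_mul_right _ (by omega)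
      _ = h ^ 18 := by ring
  calc _ ≤ (h ^ 18) ^ 2 + h ^ 6 := Nat.add_le_add (Nat.pow_le_pow_left hn 2) hE
    _ ≤ (h ^ 18) ^ 2 + h ^ 36 :=
      Nat.add_le_add_left (Nat.pow_le_pow_right (by omega) (by norm_num)) _
    _ = 2 * h ^ 36 := by ring
    _ ≤ h ^ 4 * h ^ 36 :=
      Nat.mul_le_mul_right _ (le_trans (by omega) (Nat.le_self_pow (by norm_num) h))
    _ = h ^ 40 := by ring

/-- Reduction to the comparison of representations by `s, a, b` and by `k, a, b`. -/
theorem card_partsD_le_card_partsI_of_surplus {L s k a b N G E : ℕ} (hs : 0 < s) (hk : s < k)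
    (ha : s < a) (haL : a ≤ L + s) (hb : s < b) (hbL : b ≤ L + s) (hka : k ≠ a) (hkb : k ≠ b)
    (hab : a ≠ b) (hE : 0 < E) (hG : 0 < G)
    (key : ∀ n, 0 < n → n ^ 2 + G * (tripleSols k a b n).card ≤
      G * ((tripleSols s a b n).filter fun t => 1 ≤ t.1).card + E * n)
    (hN : (E + G * E ^ 2) ^ 2 + E ≤ N) :
    (partsD L s N).card ≤ (partsI L s k N).card := by
  have hW : ∀ i ∈ otherParts L s k a b, 0 < i := fun i hi => by
    rw [mem_otherParts] at hi; omega
  have hmid : ∀ n, E ≤ n → (tripleSols k a b n).card ≤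
      ((tripleSols s a b n).filter fun t => 1 ≤ t.1).card := by
    intro n hn
    have h := key n (hE.trans_le hn)
    refine Nat.le_of_mul_le_mul_left ?_ hG
    have : E * n ≤ n ^ 2 := by rw [sq]; exact Nat.mul_le_mul_right _ hn
    omega
  have hlow : ∀ n < E, (tripleSols k a b n).card ≤ E ^ 2 := fun n hn =>
    (card_tripleSols_le k a b n (hs.trans hk) (hs.trans ha) (hs.trans hb)).trans
      (Nat.pow_le_pow_left hn 2)
  have hhigh : ∀ n, E + G * E ^ 2 ≤ n → (tripleSols k a b n).card + E ^ 2 * n ≤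
      ((tripleSols s a b n).filter fun t => 1 ≤ t.1).card := by
    intro n hn
    have h := key n (hE.trans_le ((Nat.le_add_right _ _).trans hn))
    refine Nat.le_of_mul_le_mul_left ?_ hG
    -- The term `E * n` absorbs the error in `key`; `G * E ^ 2 * n` supplies the surplus, with `E ^
    -- 2` the deficit bound from `hlow`.
    have h1 : (E + G * E ^ 2) * n ≤ n ^ 2 := by rw [sq n]; exact Nat.mul_le_mul_right _ hn
    rw [add_mul, mul_assoc] at h1
    rw [mul_add]
    omega
  obtain ⟨φ, hφ, hcard⟩ := exists_transport hW (Nat.add_pos_left hE _) hN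
  have hD := card_partsD_le (L := L) (s := s) (N := N) (hs.trans hk) (hs.trans ha) (hs.trans hb)
    hka hkb hab
  have hI := le_card_partsI (N := N) hs hk ha haL hb hbL hka hkb hab
  have hDI := sum_le_sum_of_transport _ (fun ρ => N - ρ.sum)
    (fun n => ((tripleSols s a b n).filter fun t => 1 ≤ t.1).card)
    (fun n => (tripleSols k a b n).card) E (E + G * E ^ 2) (E ^ 2) (Nat.le_add_right _ _)
    hmid hlow hhigh φ hφ hcard
  exact hD.trans (hDI.trans hI)

/-- The inequality for an arbitrary forbidden part `k`, with a bound polynomial in `s`. -/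
theorem card_partsD_le_card_partsI {L s k N : ℕ} (hL : 3 ≤ L) (hs : 1 ≤ s) (hk : s + 1 ≤ k)
    (hkL : k ≤ L + s) (hN : (s + 3) ^ 40 ≤ N) :
    (partsD L s N).card ≤ (partsI L s k N).card := by
  have hNE := (bound_le_pow_forty (by omega : 4 ≤ s + 3)).trans hN
  clear hN
  obtain ⟨F, hF⟩ : ∃ F, F = (s + 3) ^ 4 := ⟨_, rfl⟩
  have hF0 : 0 < F := by rw [hF]; positivity
  rw [← hF] at hNE
  obtain ⟨a, b, ha, haH, haL, hb, hbH, hbL, hka, hkb, hab, hcop⟩ : ∃ a b : ℕ,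
      s < a ∧ a ≤ s + 3 ∧ a ≤ L + s ∧ s < b ∧ b ≤ s + 3 ∧ b ≤ L + s ∧ k ≠ a ∧ k ≠ b ∧ a ≠ b ∧
      (a.Coprime b ∨ (a = s + 1 ∧ b = s + 3 ∧ k = s + 2)) := by
    -- Two of `s + 1, s + 2, s + 3` avoid `k`; they can be taken consecutive, hence coprime, unless
    -- `k = s + 2`.
    rcases (by omega : k = s + 1 ∨ k = s + 2 ∨ s + 3 ≤ k) with h | h | h
    · refine ⟨s + 2, s + 2 + 1, by omega, by omega, by omega, by omega, by omega, by omega,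
        by omega, by omega, by omega, Or.inl (by simp)⟩
    · exact ⟨s + 1, s + 3, by omega, by omega, by omega, by omega, by omega, by omega,
        by omega, by omega, by omega, Or.inr ⟨rfl, rfl, h⟩⟩
    · refine ⟨s + 1, s + 1 + 1, by omega, by omega, by omega, by omega, by omega, by omega,
        by omega, by omega, by omega, Or.inl (by simp)⟩
  have hG : 2 * a * b * s * (s + 1) ≤ 2 * F := by
    rw [hF]
    calc 2 * a * b * s * (s + 1) ≤ 2 * (s + 3) * (s + 3) * (s + 3) * (s + 3) := by
          gcongr <;> omega
      _ = _ := by ring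
  have hG0 : 0 < 2 * a * b * s * (s + 1) := by
    have h1 : 0 < a := by omega
    have h2 : 0 < b := by omega
    positivity
  refine card_partsD_le_card_partsI_of_surplus (E := 10 * F) hs hk ha haL hb hbL hka hkb hab
    (by omega) hG0 (fun n hn => ?_) (le_trans (Nat.add_le_add_right (Nat.pow_le_pow_left
      (Nat.add_le_add_left (Nat.mul_le_mul_right _ hG) _) 2) _) hNE)
  rw [hF]
  exact sq_add_card_le hs (by omega) (by omega) hk haH hbH hn hcop

lemma pow_le_GammaBound {s : ℕ} (hs : 1 ≤ s) : (s + 3) ^ 40 ≤ GammaBound s := by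
  have hP : s + 3 ≤ P (3 * s + 2) s :=
    Nat.le_of_dvd (Finset.prod_pos fun i _ => by omega)
      (Finset.dvd_prod_of_mem (fun i => s + i) (Finset.mem_Icc.2 ⟨by omega, by omega⟩))
  have hsum : 1 ≤ ∑ i ∈ Finset.Icc 1 (3 * s + 2), (s + i) :=
    le_trans (by omega : 1 ≤ s + 1) (Finset.single_le_sum (f := fun i => s + i)
      (fun _ _ => Nat.zero_le _) (Finset.mem_Icc.2 ⟨le_rfl, by omega⟩))
  rw [GammaBound, gammaBound]
  generalize P (3 * s + 2) s = p at *
  have hp : 4 ≤ p := by omega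
  have hexp : 40 ≤ (p ^ 2 - 1) * (3 * s + 2) + 2 := by
    have h1 : 15 ≤ p ^ 2 - 1 := by
      have : 4 ^ 2 ≤ p ^ 2 := Nat.pow_le_pow_left hp 2
      omega
    have := Nat.mul_le_mul h1 (by omega : 5 ≤ 3 * s + 2)
    omega
  calc (s + 3) ^ 40 ≤ p ^ 40 := Nat.pow_le_pow_left hP 40
    _ ≤ p ^ ((p ^ 2 - 1) * (3 * s + 2) + 2) := Nat.pow_le_pow_right (by omega) hexp
    _ ≤ p ^ ((p ^ 2 - 1) * (3 * s + 2) + 2) + ((p ^ 2 - 1) * (3 * s + 2) - 2) * p :=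
      Nat.le_add_right _ _
    _ ≤ _ := Nat.le_mul_of_pos_left _ hsum

end PartIneq

theorem mainTheorem3 (L s : ℕ) (hL : 3 ≤ L) (hs : 1 ≤ s) (N : ℕ)
    (hN : PartIneq.GammaBound s ≤ N) :
    (PartIneq.partsD L s N).card ≤ (PartIneq.partsC L s N).card ∧
      (s + 1 ≤ L → (PartIneq.partsD L s N).card ≤ (PartIneq.partsCStar L s N).card) := by
  have hN' := (PartIneq.pow_le_GammaBound hs).trans hN
  exact ⟨PartIneq.card_partsD_le_card_partsI hL hs (by omega) (by omega) hN',
    fun h => PartIneq.card_partsD_le_card_partsI hL hs h (by omega) hN'⟩
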